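/- Let $f:\mathbb R^n\to\mathbb R$ be differentiable with Lipschitz continuous gradient, and let $g:\mathbb R^n\to\mathbb R\cup\{+\infty\}$ be proper and lower semicontinuous. Assume that $g$ is $\gamma_g$-prox-bounded for some $\gamma_g\in(0,+\infty]$, i.e. $g+\frac1{2\gamma}\|\cdot\|^2$ is bounded below for every $\gamma\in(0,\gamma_g)$; that $g$ is $\rho$-weakly convex, i.e. $g+\frac\rho2\|\cdot\|^2$ is convex; and that $f+g$ has a minimizer. For $\gamma>0$ put $$\operatorname{prox}_{\gamma g}(y)=\operatorname*{argmin}_z\Big\{g(z)+\tfrac1{2\gamma}\|z-y\|^2\Big\},\quad T_\gamma(x)=\operatorname{prox}_{\gamma g}(x-\gamma\nabla f(x)),\quad R_\gamma(x)=\gamma^{-1}(x-T_\gamma(x)),$$ $$\varphi_\gamma(x)=\inf_{u}\Big\{f(x)+\langle\nabla f(x),u-x\rangle+g(u)+\tfrac1{2\gamma}\|u-x\|^2\Big\}.$$ Let $x^\star$ be a critical point, i.e. $x^\star\in T_{\gamma'}(x^\star)$ for some $\gamma'\in(0,\gamma_g)$, and assume that $f$ is of class $C^3$ near $x^\star$.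 Then, for all sufficiently small $\gamma>0$, $\operatorname{prox}_{\gamma g}$ is single-valued and $\varphi_\gamma$ is finite on $\mathbb R^n$, and, if $\operatorname{prox}_{\gamma g}$ is of class $C^1$ near $x^\star-\gamma\nabla f(x^\star)$, the following holds. There is an open neighborhood $U$ of $x^\star$ on which $f$ is $C^3$ and $\varphi_\gamma$ is $C^2$, such that for every $x\in U$ the map $\operatorname{prox}_{\gamma g}$ is differentiable at $x-\gamma\nabla f(x)$ and, with $$Q_\gamma(x)=I-\gamma\nabla^2 f(x),\qquad P_\gamma(x)=J\operatorname{prox}_{\gamma g}(x-\gamma\nabla f(x)),\qquad B(x)=\gamma^{-1}Q_\gamma(x)\big(I-P_\gamma(x)Q_\gamma(x)\big),$$ $$[M_\gamma(x)]_{i,k}=\sum_{j=1}^n\frac{\partial[Q_\gamma(x)]_{i,j}}{\partial x_k}\,[R_\gamma(x)]_j ,$$ the generalized (Gauss–Newton) Hessian $$\hat\partial^2\varphi_\gamma(x)=\Big\{\gamma^{-1}\mathcal Q(I-\mathcal P\mathcal Q)\ :\ \mathcal P\in\partial_C\operatorname{prox}_{\gamma g}(x-\gamma\nabla f(x)),\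 \mathcal Q\in\partial_C(\mathrm{id}-\gamma\nabla f)(x)\Big\},$$ where $\partial_C$ denotes the Clarke generalized Jacobian, is the singleton $\{B(x)\}$, and $$\|\nabla^2\varphi_\gamma(x)-B(x)\|=\|M_\gamma(x)\|\le\gamma\,\|\nabla^3 f(x)\|\,\|R_\gamma(x)\| .$$ Here $\|\cdot\|$ is the Euclidean norm and the operator norms it induces on matrices and on trilinear forms. -/

import Mathlib

open Filter Topology

noncomputable section

namespace FBE

section General

variable {E : Type*} [NormedAddCommGroup E] [InnerProductSpace ℝ E]

/-- Convexity of an extended-real-valued function that does not take the value `-∞`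
(in `EReal`, `0 * ⊤ = 0`, so the inequality is trivial for `a = 0` and for `b = 0`). -/
def ConvexFun (h : E → EReal) : Prop :=
  ∀ x y : E, ∀ a b : ℝ, 0 ≤ a → 0 ≤ b → a + b = 1 →
    h (a • x + b • y) ≤ (a : EReal) * h x + (b : EReal) * h y

/-- `g` is `ρ`-weakly convex: `g + (ρ / 2) ‖·‖²` is convex. -/
def WeaklyConvex (ρ : ℝ) (g : E → EReal) : Prop :=
  ConvexFun fun x => g x + ((ρ / 2 * ‖x‖ ^ 2 : ℝ) : EReal)

/-- `g : E → ℝ ∪ {+∞}` is proper: it never takes the value `-∞` and is finite somewhere. -/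
def Proper (g : E → EReal) : Prop :=
  (∀ x, g x ≠ ⊥) ∧ ∃ x, g x ≠ ⊤

/-- `g` is `γg`-prox-bounded, with `γg ∈ (0, +∞]`: for every real `γ ∈ (0, γg)`
the function `g + ‖·‖² / (2γ)` is bounded below. -/
def ProxBounded (γg : EReal) (g : E → EReal) : Prop :=
  0 < γg ∧ ∀ γ : ℝ, 0 < γ → (γ : EReal) < γg →
    ∃ m : ℝ, ∀ x, (m : EReal) ≤ g x + ((1 / (2 * γ) * ‖x‖ ^ 2 : ℝ) : EReal)

/-- The set-valued proximal mapping `argmin_z g(z) + ‖z - y‖² / (2γ)`. -/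
def proxSet (γ : ℝ) (g : E → EReal) (y : E) : Set E :=
  {z | ∀ w, g z + ((1 / (2 * γ) * ‖z - y‖ ^ 2 : ℝ) : EReal) ≤
    g w + ((1 / (2 * γ) * ‖w - y‖ ^ 2 : ℝ) : EReal)}

open Classical in
/-- The proximal mapping as a function: an element of `proxSet γ g y`, hence its only element
where the set-valued proximal mapping is single-valued (the value is irrelevant where the
set is empty). -/
def prox (γ : ℝ) (g : E → EReal) (y : E) : E :=
  if h : (proxSet γ g y).Nonempty then h.some else y

/-- The Clarke generalized Jacobian: convex hull of all limits of Jacobians `F'(u k)` along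
sequences `u k → x` of points of differentiability of `F`. -/
def clarkeJacobian (F : E → E) (x : E) : Set (E →L[ℝ] E) :=
  convexHull ℝ {A | ∃ u : ℕ → E, Tendsto u atTop (𝓝 x) ∧
    (∀ k, DifferentiableAt ℝ F (u k)) ∧ Tendsto (fun k => fderiv ℝ F (u k)) atTop (𝓝 A)}

variable [CompleteSpace E]

/-- The Hessian as a linear operator, `∇²f(x) = D(∇f)(x)`. -/
def hessian (f : E → ℝ) (x : E) : E →L[ℝ] E := fderiv ℝ (gradient f) x

/-- The forward step `x ↦ x - γ ∇f(x)`. -/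
def forward (f : E → ℝ) (γ : ℝ) (x : E) : E := x - γ • gradient f x

/-- The (set-valued) proximal gradient mapping `T_γ(x) = prox_{γg}(x - γ ∇f(x))`. -/
def proxGrad (f : E → ℝ) (g : E → EReal) (γ : ℝ) (x : E) : Set E :=
  proxSet γ g (forward f γ x)

/-- `x` is a critical point: `x ∈ T_γ(x)` for some `γ ∈ (0, γg)`. -/
def IsCritical (f : E → ℝ) (g : E → EReal) (γg : EReal) (x : E) : Prop :=
  ∃ γ : ℝ, 0 < γ ∧ (γ : EReal) < γg ∧ x ∈ proxGrad f g γ x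

/-- The forward-backward envelope as an extended-real-valued infimum. -/
def envelopeInf (f : E → ℝ) (g : E → EReal) (γ : ℝ) (x : E) : EReal :=
  ⨅ u : E, g u +
    ((f x + inner ℝ (gradient f x) (u - x) + 1 / (2 * γ) * ‖u - x‖ ^ 2 : ℝ) : EReal)

/-- The forward-backward envelope `φ_γ` as a real-valued function. -/
def envelope (f : E → ℝ) (g : E → EReal) (γ : ℝ) (x : E) : ℝ :=
  (envelopeInf f g γ x).toReal

/-- The fixed-point residual `R_γ(x) = γ⁻¹ (x - T_γ(x))`. -/
def residual (f : E → ℝ) (g : E → EReal) (γ : ℝ) (x : E) : E :=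
  γ⁻¹ • (x - prox γ g (forward f γ x))

/-- `Q_γ(x) = I - γ ∇²f(x)`. -/
def Q (f : E → ℝ) (γ : ℝ) (x : E) : E →L[ℝ] E :=
  ContinuousLinearMap.id ℝ E - γ • hessian f x

/-- `P_γ(x)`, the Jacobian of `prox_{γg}` at `x - γ ∇f(x)`. -/
def P (f : E → ℝ) (g : E → EReal) (γ : ℝ) (x : E) : E →L[ℝ] E :=
  fderiv ℝ (prox γ g) (forward f γ x)

/-- `M_γ(x)`, the operator `v ↦ (DQ_γ(x)[v]) R_γ(x)`; its matrix entries are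
`[M_γ(x)]_{i,k} = ∑ j, ∂_k [Q_γ]_{i,j}(x) [R_γ(x)]_j`, see `M_entry`. -/
def M (f : E → ℝ) (g : E → EReal) (γ : ℝ) (x : E) : E →L[ℝ] E :=
  (fderiv ℝ (Q f γ) x).flip (residual f g γ x)

/-- `B(x) = γ⁻¹ Q_γ(x) (I - P_γ(x) Q_γ(x))`. -/
def B (f : E → ℝ) (g : E → EReal) (γ : ℝ) (x : E) : E →L[ℝ] E :=
  γ⁻¹ • (Q f γ x ∘L (ContinuousLinearMap.id ℝ E - P f g γ x ∘L Q f γ x))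

/-- The set-valued generalized (Gauss-Newton) Hessian of the forward-backward envelope: all
`γ⁻¹ 𝒬 (I - 𝒫 𝒬)`, where `𝒫` is in the Clarke Jacobian of `prox_{γg}` at `x - γ ∇f(x)`
and `𝒬` is in the Clarke Jacobian of the forward step at `x`. -/
def generalizedHessian (f : E → ℝ) (g : E → EReal) (γ : ℝ) (x : E) : Set (E →L[ℝ] E) :=
  {H | ∃ P' ∈ clarkeJacobian (prox γ g) (forward f γ x),
    ∃ Q' ∈ clarkeJacobian (forward f γ) x,
      H = γ⁻¹ • (Q' ∘L (ContinuousLinearMap.id ℝ E - P' ∘L Q'))}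

end General

/-- The entries of the matrix of `M_γ(x)` in the standard basis. -/
theorem M_entry {n : ℕ} (f : EuclideanSpace ℝ (Fin n) → ℝ) (g : EuclideanSpace ℝ (Fin n) → EReal)
    (γ : ℝ) (x : EuclideanSpace ℝ (Fin n)) (hQ : DifferentiableAt ℝ (Q f γ) x) (i k : Fin n) :
    M f g γ x (EuclideanSpace.single k 1) i =
      ∑ j, fderiv ℝ (fun y => Q f γ y (EuclideanSpace.single j 1) i) x
        (EuclideanSpace.single k 1) * residual f g γ x j := by
  have h1 : ∀ j : Fin n, fderiv ℝ (fun y => Q f γ y (EuclideanSpace.single j 1) i) x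
      (EuclideanSpace.single k 1) =
      (fderiv ℝ (Q f γ) x (EuclideanSpace.single k 1)) (EuclideanSpace.single j 1) i := by
    intro j
    have h := ((EuclideanSpace.proj i : EuclideanSpace ℝ (Fin n) →L[ℝ] ℝ) ∘L
      ContinuousLinearMap.apply ℝ (EuclideanSpace ℝ (Fin n))
        (EuclideanSpace.single j (1 : ℝ))).hasFDerivAt.comp x hQ.hasFDerivAt
    have h' : fderiv ℝ (fun y => Q f γ y (EuclideanSpace.single j 1) i) x = _ := h.fderiv
    rw [h']
    rfl
  simp only [h1, M, ContinuousLinearMap.flip_apply]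
  set A := fderiv ℝ (Q f γ) x (EuclideanSpace.single k 1)
  set r := residual f g γ x
  have hr : r = ∑ j, r j • EuclideanSpace.single j (1 : ℝ) := by
    ext l
    simp [Pi.single_apply]
  conv_lhs => rw [hr]
  simp [mul_comm]

end FBE

end

namespace FBE

/-! Completing the square turns the envelope into `f - γ/2 ‖∇f‖²` plus the Moreau envelope of `g` at
the forward step (`envelope_eq`). The Moreau envelope has gradient `γ⁻¹ (y - prox y)` wherever prox
is continuous (`hasFDerivAt_moreau`), so the chain rule and the symmetry of `Q` give `∇φ = Q R`. The
product rule splits the Hessian: differentiating `Q` gives `M`, differentiating `R` gives `B`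
(`hessian_envelope`). The bound on `M` follows from `DQ = -γ D(∇²f)`, and Clarke Jacobians of `C¹`
maps are singletons. Prox-boundedness and lower semicontinuity give proximal points; weak convexity
makes them unique for small `γ`. -/

theorem lowerSemicontinuous_add_coe {X : Type*} [TopologicalSpace X] {g : X → EReal}
    (hg : LowerSemicontinuous g) {q : X → ℝ} (hq : Continuous q) :
    LowerSemicontinuous fun x => g x + (q x : EReal) :=
  hg.add' (continuous_coe_real_ereal.comp hq).lowerSemicontinuous fun _ =>
    EReal.continuousAt_add (Or.inr (EReal.coe_ne_bot _)) (Or.inr (EReal.coe_ne_top _))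

/-! ### Existence of proximal points -/

section Normed

variable {E : Type*} [NormedAddCommGroup E]

/-- A quadratic of larger curvature, centred anywhere, dominates one of smaller curvature. -/
theorem exists_radius_quadratic_gap {a b : ℝ} (ha : 0 < a) (hab : b < a) (c : ℝ) (y : E) :
    ∃ r : ℝ, ∀ z : E, r ≤ ‖z‖ → c ≤ a * ‖z - y‖ ^ 2 - b * ‖z‖ ^ 2 := by
  have hd : 0 < a - b := sub_pos.2 hab
  -- The quotient makes `(a - b)‖z‖ - 2a‖y‖ ≥ |c|`; the `+ 1` gives `‖z‖ ≥ 1`, so multiplying by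
  -- `‖z‖` keeps the bound.
  refine ⟨(2 * a * ‖y‖ + |c|) / (a - b) + 1, fun z hz => ?_⟩
  have hq : 0 ≤ (2 * a * ‖y‖ + |c|) / (a - b) := by positivity
  have h1 : 1 ≤ ‖z‖ := by linarith
  have h2 : 2 * a * ‖y‖ + |c| ≤ (a - b) * ‖z‖ := by
    have h := (div_le_iff₀ hd).1 (show (2 * a * ‖y‖ + |c|) / (a - b) ≤ ‖z‖ by linarith)
    linarith
  have h3 : (‖z‖ - ‖y‖) ^ 2 ≤ ‖z - y‖ ^ 2 :=
    sq_le_sq.2 (by simpa using abs_norm_sub_norm_le z y)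
  have h4 : |c| ≤ ‖z‖ * ((a - b) * ‖z‖ - 2 * a * ‖y‖) := by
    nlinarith [abs_nonneg c]
  nlinarith [le_abs_self c, mul_le_mul_of_nonneg_left h3 ha.le,
    mul_nonneg ha.le (sq_nonneg ‖y‖)]

theorem ne_top_of_mem_proxSet {g : E → EReal} (hp : Proper g) {γ : ℝ} {y z : E}
    (hz : z ∈ proxSet γ g y) : g z ≠ ⊤ := by
  obtain ⟨w, hw⟩ := hp.2
  intro h
  have h1 := hz w
  rw [h, EReal.top_add_coe, top_le_iff] at h1
  exact EReal.add_ne_top hw (EReal.coe_ne_top _) h1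

theorem prox_mem_proxSet {g : E → EReal} {γ : ℝ} {y : E} (h : (proxSet γ g y).Nonempty) :
    prox γ g y ∈ proxSet γ g y := by
  rw [prox, dif_pos h]
  exact h.some_mem

/-- Since `γ < γ₀`, the objective outside a large ball is at least its value at a fixed point `z₀`
of the domain, so a minimizer over the compact ball is global. -/
theorem proxSet_nonempty [ProperSpace E] {g : E → EReal} (hp : Proper g)
    (hlsc : LowerSemicontinuous g) {γ γ₀ m : ℝ} (hγ : 0 < γ) (hγ₀ : γ < γ₀)
    (hm : ∀ x, (m : EReal) ≤ g x + ((1 / (2 * γ₀) * ‖x‖ ^ 2 : ℝ) : EReal)) (y : E) :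
    (proxSet γ g y).Nonempty := by
  obtain ⟨z₀, hz₀⟩ := hp.2
  lift g z₀ to ℝ using ⟨hz₀, hp.1 z₀⟩ with t ht
  obtain ⟨r, hr⟩ := exists_radius_quadratic_gap (a := 1 / (2 * γ)) (b := 1 / (2 * γ₀))
    (by positivity) (by gcongr) (t + 1 / (2 * γ) * ‖z₀ - y‖ ^ 2 - m) y
  have hl : LowerSemicontinuous fun z => g z + ((1 / (2 * γ) * ‖z - y‖ ^ 2 : ℝ) : EReal) :=
    lowerSemicontinuous_add_coe hlsc (by fun_prop)
  have hmem : z₀ ∈ Metric.closedBall (0 : E) (max r ‖z₀‖) := by simp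
  obtain ⟨z, -, hz⟩ := (hl.lowerSemicontinuousOn _).exists_isMinOn ⟨z₀, hmem⟩
    (isCompact_closedBall (0 : E) (max r ‖z₀‖))
  refine ⟨z, fun w => ?_⟩
  by_cases hw : w ∈ Metric.closedBall (0 : E) (max r ‖z₀‖)
  · exact hz hw
  refine (hz hmem).trans ?_
  have hrw : r ≤ ‖w‖ := by
    simp only [Metric.mem_closedBall, dist_zero_right, not_le] at hw
    exact (le_max_left _ _).trans hw.le
  have h1 := hr w hrw
  have h2 := hm w
  simp only [← ht]
  induction h : g w with
  | bot => exact absurd h (hp.1 w)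
  | top => rw [EReal.top_add_coe]; exact le_top
  | coe s =>
    rw [h] at h2
    norm_cast at h2 ⊢
    linarith

/-- The value of the Moreau envelope at `y`, attained at `prox γ g y`. -/
noncomputable def moreau (γ : ℝ) (g : E → EReal) (y : E) : ℝ :=
  (g (prox γ g y)).toReal + 1 / (2 * γ) * ‖prox γ g y - y‖ ^ 2

theorem coe_moreau {g : E → EReal} (hp : Proper g) {γ : ℝ} {y : E}
    (h : (proxSet γ g y).Nonempty) :
    (moreau γ g y : EReal) =
      g (prox γ g y) + ((1 / (2 * γ) * ‖prox γ g y - y‖ ^ 2 : ℝ) : EReal) := by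
  rw [moreau, EReal.coe_add,
    EReal.coe_toReal (ne_top_of_mem_proxSet hp (prox_mem_proxSet h)) (hp.1 _)]

end Normed

/-! ### Uniqueness of proximal points and smoothness of the Moreau envelope -/

section Prox

variable {E : Type*} [NormedAddCommGroup E] [InnerProductSpace ℝ E]

theorem norm_midpoint_sub_sq (a b y : E) :
    ‖(1 / 2 : ℝ) • a + (1 / 2 : ℝ) • b - y‖ ^ 2 =
      1 / 2 * ‖a - y‖ ^ 2 + 1 / 2 * ‖b - y‖ ^ 2 - 1 / 4 * ‖a - b‖ ^ 2 := by
  have h1 : (1 / 2 : ℝ) • a + (1 / 2 : ℝ) • b - y = (1 / 2 : ℝ) • ((a - y) + (b - y)) := by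
    module
  have h2 : a - b = (a - y) - (b - y) := by abel
  rw [h1, h2, norm_smul, mul_pow, norm_add_sq_real, norm_sub_sq_real (a - y) (b - y)]
  norm_num
  ring

/-- Testing two minimizers against their midpoint and using weak convexity there leaves `(1/(2γ) -
ρ/2) ‖a - b‖² ≤ 0`. -/
theorem proxSet_subsingleton {g : E → EReal} (hp : Proper g) {ρ : ℝ} (hwc : WeaklyConvex ρ g)
    {γ : ℝ} (hγ : 0 < γ) (hργ : ρ * γ < 1) (y : E) : (proxSet γ g y).Subsingleton := by
  intro a ha b hb
  have ha' := ne_top_of_mem_proxSet hp ha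
  have hb' := ne_top_of_mem_proxSet hp hb
  have hc := hwc a b (1 / 2) (1 / 2) (by norm_num) (by norm_num) (by norm_num)
  have hac := ha ((1 / 2 : ℝ) • a + (1 / 2 : ℝ) • b)
  have hbc := hb ((1 / 2 : ℝ) • a + (1 / 2 : ℝ) • b)
  have hbot := hp.1 ((1 / 2 : ℝ) • a + (1 / 2 : ℝ) • b)
  have hm := norm_midpoint_sub_sq a b y
  have hm0 := norm_midpoint_sub_sq a b 0
  simp only [sub_zero] at hm0
  lift g a to ℝ using ⟨ha', hp.1 a⟩ with s hs
  lift g b to ℝ using ⟨hb', hp.1 b⟩ with t ht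
  generalize (1 / 2 : ℝ) • a + (1 / 2 : ℝ) • b = c at *
  induction h : g c with
  | bot => exact absurd h hbot
  | top =>
    rw [h, EReal.top_add_coe, top_le_iff] at hc
    exact absurd hc (EReal.coe_ne_top (1 / 2 * (s + ρ / 2 * ‖a‖ ^ 2) + 1 / 2 * (t + ρ / 2 * ‖b‖ ^ 2)))
  | coe u =>
    rw [h] at hc hac hbc
    norm_cast at hc hac hbc
    rw [hm] at hac hbc
    rw [hm0] at hc
    have hk : 0 < 1 / (2 * γ) - ρ / 2 := by
      have : 1 / (2 * γ) - ρ / 2 = (1 - ρ * γ) / (2 * γ) := by field_simp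
      rw [this]
      exact div_pos (by linarith) (by linarith)
    have hle : (1 / (2 * γ) - ρ / 2) * ‖a - b‖ ^ 2 ≤ 0 := by linarith
    have h0 : ‖a - b‖ ^ 2 ≤ 0 := nonpos_of_mul_nonpos_right hle hk
    exact sub_eq_zero.1 (norm_eq_zero.1 (pow_eq_zero_iff two_ne_zero |>.1
      (le_antisymm h0 (sq_nonneg _))))

/-- The point `prox γ g y` is a competitor in the problem at `y'`; expand the square. -/
theorem moreau_le {g : E → EReal} (hp : Proper g) {γ : ℝ}
    (h : ∀ y, (proxSet γ g y).Nonempty) (y y' : E) :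
    moreau γ g y' ≤ moreau γ g y + inner ℝ (γ⁻¹ • (y - prox γ g y)) (y' - y)
      + 1 / (2 * γ) * ‖y' - y‖ ^ 2 := by
  have h1 : (moreau γ g y' : EReal) ≤
      (((g (prox γ g y)).toReal + 1 / (2 * γ) * ‖prox γ g y - y'‖ ^ 2 : ℝ) : EReal) := by
    rw [coe_moreau hp (h y'), EReal.coe_add,
      EReal.coe_toReal (ne_top_of_mem_proxSet hp (prox_mem_proxSet (h y))) (hp.1 _)]
    exact prox_mem_proxSet (h y') _
  refine (EReal.coe_le_coe_iff.1 h1).trans_eq ?_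
  rw [moreau]
  have h2 : prox γ g y - y' = (prox γ g y - y) - (y' - y) := by abel
  have h3 : y - prox γ g y = -(prox γ g y - y) := by abel
  rw [h2, h3, norm_sub_sq_real, real_inner_smul_left, inner_neg_left, one_div, mul_inv]
  ring

/-- `moreau_le` bounds the remainder above; with `y` and `y'` exchanged it bounds it below, up to
the variation of `γ⁻¹ (y - prox y)`, which continuity makes small. No convexity enters. -/
theorem hasFDerivAt_moreau {g : E → EReal} (hp : Proper g) {γ : ℝ} (hγ : 0 < γ)
    (h : ∀ y, (proxSet γ g y).Nonempty) {y : E} (hc : ContinuousAt (prox γ g) y) :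
    HasFDerivAt (moreau γ g) (innerSL ℝ (γ⁻¹ • (y - prox γ g y))) y := by
  rw [hasFDerivAt_iff_isLittleO, Asymptotics.isLittleO_iff]
  intro c hcpos
  set s : E → E := fun y => γ⁻¹ • (y - prox γ g y) with hs
  have hsc : ContinuousAt s y := (continuousAt_id.sub hc).const_smul _
  have e1 : ∀ᶠ y' in 𝓝 y, ‖s y' - s y‖ < c / 2 := by
    simpa [dist_eq_norm] using Metric.tendsto_nhds.1 hsc.tendsto (c / 2) (by positivity)
  have e2 : ∀ᶠ y' in 𝓝 y, ‖y' - y‖ < γ * c := by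
    filter_upwards [Metric.ball_mem_nhds y (mul_pos hγ hcpos)] with y' hy'
    rwa [← dist_eq_norm]
  filter_upwards [e1, e2] with y' h1 h2
  have u1 := moreau_le hp h y y'
  have u2 := moreau_le hp h y' y
  change _ ≤ _ + inner ℝ (s y) _ + _ at u1
  change _ ≤ _ + inner ℝ (s y') _ + _ at u2
  rw [← neg_sub y' y, inner_neg_right, norm_neg] at u2
  have u3 : inner ℝ (s y' - s y) (y' - y) = inner ℝ (s y') (y' - y) - inner ℝ (s y) (y' - y) :=
    inner_sub_left _ _ _
  have u4 : |inner ℝ (s y' - s y) (y' - y)| ≤ c / 2 * ‖y' - y‖ :=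
    (abs_real_inner_le_norm _ _).trans (by gcongr)
  have u5 : 1 / (2 * γ) * ‖y' - y‖ ^ 2 ≤ c / 2 * ‖y' - y‖ := by
    have : 1 / (2 * γ) * ‖y' - y‖ ≤ c / 2 := by
      rw [one_div_mul_eq_div, div_le_iff₀ (by positivity)]
      linarith
    calc 1 / (2 * γ) * ‖y' - y‖ ^ 2 = 1 / (2 * γ) * ‖y' - y‖ * ‖y' - y‖ := by ring
      _ ≤ _ := by gcongr
  have u6 := abs_le.1 u4
  have u7 : 0 ≤ c * ‖y' - y‖ := by positivity
  rw [innerSL_apply_apply, Real.norm_eq_abs, abs_le]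
  constructor <;> linarith

theorem contDiffOn_moreau {g : E → EReal} (hp : Proper g) {γ : ℝ} (hγ : 0 < γ)
    (h : ∀ y, (proxSet γ g y).Nonempty) {W : Set E} (hW : IsOpen W)
    (hC : ContDiffOn ℝ 1 (prox γ g) W) : ContDiffOn ℝ 2 (moreau γ g) W := by
  have hd : ∀ y ∈ W, HasFDerivAt (moreau γ g) (innerSL ℝ (γ⁻¹ • (y - prox γ g y))) y :=
    fun y hy => hasFDerivAt_moreau hp hγ h (hC.continuousOn.continuousAt (hW.mem_nhds hy))
  rw [show (2 : WithTop ℕ∞) = 1 + 1 by norm_num, contDiffOn_succ_iff_fderiv_of_isOpen hW]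
  refine ⟨fun y hy => (hd y hy).differentiableAt.differentiableWithinAt, by simp, ?_⟩
  refine ContDiffOn.congr ?_ fun y hy => (hd y hy).fderiv
  exact (innerSL ℝ).contDiff.comp_contDiffOn ((contDiffOn_id.sub hC).const_smul _)

end Prox

/-! ### Clarke Jacobians of `C¹` maps -/

section Clarke

variable {E : Type*} [NormedAddCommGroup E] [InnerProductSpace ℝ E]

theorem clarkeJacobian_eq_singleton {F : E → E} {x : E} (hF : ContDiffAt ℝ 1 F x) :
    clarkeJacobian F x = {fderiv ℝ F x} := by
  have hset : {A | ∃ u : ℕ → E, Tendsto u atTop (𝓝 x) ∧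
      (∀ k, DifferentiableAt ℝ F (u k)) ∧ Tendsto (fun k => fderiv ℝ F (u k)) atTop (𝓝 A)} =
      {fderiv ℝ F x} := by
    ext A
    simp only [Set.mem_ofPred_eq, Set.mem_singleton_iff]
    constructor
    · rintro ⟨u, hu, -, hA⟩
      exact tendsto_nhds_unique hA
        ((hF.continuousAt_fderiv (by norm_num)).tendsto.comp hu)
    · rintro rfl
      exact ⟨fun _ => x, tendsto_const_nhds, fun _ => hF.differentiableAt (by norm_num),
        tendsto_const_nhds⟩
  rw [clarkeJacobian, hset, convexHull_singleton]

end Clarke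

/-! ### Derivatives of the forward-backward envelope -/

section Envelope

variable {E : Type*} [NormedAddCommGroup E] [InnerProductSpace ℝ E] [CompleteSpace E]

theorem envelope_summand_eq (f : E → ℝ) {γ : ℝ} (hγ : 0 < γ) (x u : E) :
    f x + inner ℝ (gradient f x) (u - x) + 1 / (2 * γ) * ‖u - x‖ ^ 2 =
      1 / (2 * γ) * ‖u - forward f γ x‖ ^ 2 + (f x - γ / 2 * ‖gradient f x‖ ^ 2) := by
  have h : u - forward f γ x = (u - x) + γ • gradient f x := by
    rw [forward]; abel
  rw [h, norm_add_sq_real, inner_smul_right, norm_smul, real_inner_comm (u - x), mul_pow,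
    Real.norm_eq_abs, sq_abs]
  field_simp
  ring

theorem envelopeInf_eq {f : E → ℝ} {g : E → EReal} (hp : Proper g) {γ : ℝ} (hγ : 0 < γ)
    (h : ∀ y, (proxSet γ g y).Nonempty) (x : E) :
    envelopeInf f g γ x =
      ((f x - γ / 2 * ‖gradient f x‖ ^ 2 + moreau γ g (forward f γ x) : ℝ) : EReal) := by
  rw [EReal.coe_add, coe_moreau hp (h _), add_comm]
  simp only [envelopeInf, envelope_summand_eq f hγ, EReal.coe_add, ← add_assoc]
  refine le_antisymm (iInf_le _ (prox γ g (forward f γ x))) (le_iInf fun u => ?_)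
  gcongr ?_ + _
  exact prox_mem_proxSet (h _) u

theorem envelope_eq {f : E → ℝ} {g : E → EReal} (hp : Proper g) {γ : ℝ} (hγ : 0 < γ)
    (h : ∀ y, (proxSet γ g y).Nonempty) (x : E) :
    envelope f g γ x =
      f x - γ / 2 * ‖gradient f x‖ ^ 2 + moreau γ g (forward f γ x) := by
  rw [envelope, envelopeInf_eq hp hγ h, EReal.toReal_coe]

theorem contDiffAt_gradient {f : E → ℝ} {x : E} {k m : WithTop ℕ∞} (hf : ContDiffAt ℝ k f x)
    (hm : m + 1 ≤ k) : ContDiffAt ℝ m (gradient f) x :=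
  (InnerProductSpace.toDual ℝ E).symm.contDiff.contDiffAt.comp x (hf.fderiv_right hm)

theorem contDiffAt_hessian {f : E → ℝ} {x : E} (hf : ContDiffAt ℝ 3 f x) :
    ContDiffAt ℝ 1 (hessian f) x :=
  (contDiffAt_gradient (m := 2) hf (by norm_num)).fderiv_right (by norm_num)

/-- Through the Riesz isomorphism this is the symmetry of the second derivative. -/
theorem inner_hessian_comm {f : E → ℝ} {x : E} (hf : ContDiffAt ℝ 2 f x) (v w : E) :
    inner ℝ (hessian f x v) w = inner ℝ v (hessian f x w) := by
  have key : ∀ v w : E, inner ℝ (hessian f x v) w = fderiv ℝ (fderiv ℝ f) x v w := by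
    intro v w
    have h1 : hessian f x v =
        (InnerProductSpace.toDual ℝ E).symm (fderiv ℝ (fderiv ℝ f) x v) := by
      have h2 : DifferentiableAt ℝ (fderiv ℝ f) x :=
        (hf.fderiv_right (m := 1) (by norm_num)).differentiableAt (by norm_num)
      have h3 := (InnerProductSpace.toDual ℝ E).symm.hasFDerivAt.comp x h2.hasFDerivAt
      have h4 : hessian f x = _ := h3.fderiv
      rw [h4]
      rfl
    rw [h1, InnerProductSpace.toDual_symm_apply]
  rw [key, ← real_inner_comm, key]
  exact hf.isSymmSndFDerivAt (by simp) v w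

theorem hasFDerivAt_forward {f : E → ℝ} {x : E} (hf : ContDiffAt ℝ 2 f x) (γ : ℝ) :
    HasFDerivAt (forward f γ) (Q f γ x) x :=
  (hasFDerivAt_id x).sub
    (((contDiffAt_gradient (m := 1) hf (by norm_num)).differentiableAt
      (by norm_num)).hasFDerivAt.const_smul γ)

theorem contDiffAt_forward {f : E → ℝ} {x : E} (hf : ContDiffAt ℝ 3 f x) (γ : ℝ) :
    ContDiffAt ℝ 2 (forward f γ) x :=
  contDiffAt_id.sub ((contDiffAt_gradient hf (by norm_num)).const_smul γ)

theorem contDiffAt_Q {f : E → ℝ} {x : E} (hf : ContDiffAt ℝ 3 f x) (γ : ℝ) :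
    ContDiffAt ℝ 1 (Q f γ) x :=
  contDiffAt_const.sub ((contDiffAt_hessian hf).const_smul γ)

theorem inner_Q_comm {f : E → ℝ} {x : E} (hf : ContDiffAt ℝ 2 f x) (γ : ℝ) (v w : E) :
    inner ℝ (Q f γ x v) w = inner ℝ v (Q f γ x w) := by
  simp [Q, inner_sub_left, inner_sub_right, inner_smul_left, inner_smul_right,
    inner_hessian_comm hf]

/-- The gradient of the forward-backward envelope is `Q_γ(x) R_γ(x)`. -/
theorem hasGradientAt_envelope {f : E → ℝ} {g : E → EReal} (hp : Proper g) {γ : ℝ} (hγ : 0 < γ)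
    (h : ∀ y, (proxSet γ g y).Nonempty) {x : E} (hf : ContDiffAt ℝ 2 f x)
    (hc : ContinuousAt (prox γ g) (forward f γ x)) :
    HasGradientAt (envelope f g γ) (Q f γ x (residual f g γ x)) x := by
  rw [hasGradientAt_iff_hasFDerivAt, funext (envelope_eq hp hγ h)]
  have hd : HasGradientAt f (gradient f x) x := (hf.differentiableAt (by norm_num)).hasGradientAt
  have hg : HasFDerivAt (gradient f) (hessian f x) x :=
    ((contDiffAt_gradient (m := 1) hf (by norm_num)).differentiableAt (by norm_num)).hasFDerivAt
  have hm := (hasFDerivAt_moreau hp hγ h hc).comp x (hasFDerivAt_forward hf γ)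
  refine ((hd.hasFDerivAt.sub (hg.norm_sq.const_mul (γ / 2))).add hm).congr_fderiv ?_
  ext v
  -- The extra term `-Q ∇f` cancels the gradient of `f - γ/2 ‖∇f‖²`.
  have hr : γ⁻¹ • (forward f γ x - prox γ g (forward f γ x)) =
      residual f g γ x - gradient f x := by
    rw [residual, forward, sub_right_comm, smul_sub _ _ (γ • _), inv_smul_smul₀ hγ.ne']
  rw [hr]
  simp only [add_apply, sub_apply,
    smul_apply, ContinuousLinearMap.comp_apply, innerSL_apply_apply,
    InnerProductSpace.toDual_apply_apply, inner_Q_comm hf, inner_sub_left]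
  simp only [Q, sub_apply, smul_apply,
    ContinuousLinearMap.id_apply, inner_sub_right, inner_smul_right, smul_eq_mul]
  ring

/-- The Hessian of the forward-backward envelope is `M_γ(x) + B(x)`. -/
theorem hessian_envelope {f : E → ℝ} {g : E → EReal} (hp : Proper g) {γ : ℝ} (hγ : 0 < γ)
    (h : ∀ y, (proxSet γ g y).Nonempty) {U : Set E} (hU : IsOpen U)
    (hf : ∀ x ∈ U, ContDiffAt ℝ 3 f x)
    (hC : ∀ x ∈ U, ContDiffAt ℝ 1 (prox γ g) (forward f γ x)) {x : E} (hx : x ∈ U) :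
    hessian (envelope f g γ) x = M f g γ x + B f g γ x := by
  have hgrad : gradient (envelope f g γ) =ᶠ[𝓝 x] fun y => Q f γ y (residual f g γ y) := by
    filter_upwards [hU.mem_nhds hx] with y hy
    exact (hasGradientAt_envelope hp hγ h ((hf y hy).of_le (by norm_num))
      (hC y hy).continuousAt).gradient
  have hP : HasFDerivAt (prox γ g) (P f g γ x) (forward f γ x) :=
    ((hC x hx).differentiableAt (by norm_num)).hasFDerivAt
  have hR : HasFDerivAt (residual f g γ)
      (γ⁻¹ • (ContinuousLinearMap.id ℝ E - P f g γ x ∘L Q f γ x)) x :=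
    ((hasFDerivAt_id x).sub
      (hP.comp x (hasFDerivAt_forward ((hf x hx).of_le (by norm_num)) γ))).const_smul γ⁻¹
  have hQ := ((contDiffAt_Q (hf x hx) γ).differentiableAt (by norm_num)).hasFDerivAt
  rw [hessian, hgrad.fderiv_eq, (hQ.clm_apply hR).fderiv, M, B, ContinuousLinearMap.comp_smul,
    add_comm]

/-- The gradient is `fderiv` followed by a linear isometry, which preserves norms of iterated
derivatives. -/
theorem norm_fderiv_hessian (f : E → ℝ) (x : E) :
    ‖fderiv ℝ (hessian f) x‖ = ‖iteratedFDeriv ℝ 3 f x‖ := by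
  have h1 : ‖fderiv ℝ (hessian f) x‖ = ‖iteratedFDeriv ℝ 2 (gradient f) x‖ := by
    rw [← norm_iteratedFDeriv_fderiv (n := 1), norm_iteratedFDeriv_one]
    rfl
  rw [h1, ← norm_iteratedFDeriv_fderiv (n := 2)]
  exact (InnerProductSpace.toDual ℝ E).symm.norm_iteratedFDeriv_comp_left (fderiv ℝ f) x 2

theorem norm_M_le {f : E → ℝ} (g : E → EReal) {γ : ℝ} (hγ : 0 < γ) {x : E}
    (hf : ContDiffAt ℝ 3 f x) :
    ‖M f g γ x‖ ≤ γ * ‖iteratedFDeriv ℝ 3 f x‖ * ‖residual f g γ x‖ := by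
  have hH := ((contDiffAt_hessian hf).differentiableAt (by norm_num)).hasFDerivAt
  have hQ : fderiv ℝ (Q f γ) x = -(γ • fderiv ℝ (hessian f) x) :=
    ((hH.const_smul γ).const_sub (ContinuousLinearMap.id ℝ E)).fderiv
  have hn : ‖fderiv ℝ (Q f γ) x‖ = γ * ‖iteratedFDeriv ℝ 3 f x‖ := by
    rw [hQ, ContinuousLinearMap.opNorm_neg, norm_smul, Real.norm_of_nonneg hγ.le, norm_fderiv_hessian]
  rw [← hn, ← ContinuousLinearMap.opNorm_flip]
  exact ContinuousLinearMap.le_opNorm _ _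

theorem contDiffAt_envelope {f : E → ℝ} {g : E → EReal} (hp : Proper g) {γ : ℝ} (hγ : 0 < γ)
    (h : ∀ y, (proxSet γ g y).Nonempty) {x : E} (hf : ContDiffAt ℝ 3 f x)
    (hC : ContDiffAt ℝ 1 (prox γ g) (forward f γ x)) :
    ContDiffAt ℝ 2 (envelope f g γ) x := by
  obtain ⟨W, hW, hxW, hCW⟩ := hC.contDiffOn' le_rfl (by simp)
  have hCW : ContDiffOn ℝ 1 (prox γ g) W := by simpa using hCW
  have hm := ((contDiffOn_moreau hp hγ h hW hCW).contDiffAt (hW.mem_nhds hxW)).comp x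
    (contDiffAt_forward hf γ)
  rw [funext (envelope_eq hp hγ h)]
  exact ((hf.of_le (by norm_num)).sub (contDiffAt_const.mul
    ((contDiffAt_gradient hf (by norm_num)).norm_sq ℝ))).add hm

theorem generalizedHessian_eq {f : E → ℝ} {g : E → EReal} {γ : ℝ} {x : E}
    (hf : ContDiffAt ℝ 3 f x) (hC : ContDiffAt ℝ 1 (prox γ g) (forward f γ x)) :
    generalizedHessian f g γ x = {B f g γ x} := by
  ext H
  simp [generalizedHessian, clarkeJacobian_eq_singleton hC,
    clarkeJacobian_eq_singleton ((contDiffAt_forward hf γ).of_le (by norm_num : (1 : WithTop ℕ∞) ≤ 2)),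
    (hasFDerivAt_forward (hf.of_le (by norm_num)) γ).fderiv, B, P]

end Envelope

end FBE

open FBE in
theorem corollary3p3 {n : ℕ}
    (f : EuclideanSpace ℝ (Fin n) → ℝ) (g : EuclideanSpace ℝ (Fin n) → EReal)
    (Lf : NNReal) (γg : EReal) (ρ : ℝ)
    -- `f` is differentiable with Lipschitz gradient
    (hf : Differentiable ℝ f) (hLf : LipschitzWith Lf (gradient f))
    -- `g` is proper, lsc, prox-bounded and weakly convex
    (hg_proper : Proper g) (hg_lsc : LowerSemicontinuous g)
    (hg_bdd : ProxBounded γg g) (hg_wc : WeaklyConvex ρ g)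
    -- `f + g` has a minimizer
    (hsol : ∃ xmin, ∀ x, (f xmin : EReal) + g xmin ≤ (f x : EReal) + g x)
    -- `xs` is a critical point, around which `f` is of class `C³`
    (xs : EuclideanSpace ℝ (Fin n)) (hxs : IsCritical f g γg xs)
    (hf3 : ContDiffAt ℝ 3 f xs) :
    ∃ γbar : ℝ, 0 < γbar ∧ ∀ γ : ℝ, 0 < γ → γ < γbar →
      -- the proximal mapping is single-valued and the envelope is finite
      (∀ y, proxSet γ g y = {prox γ g y}) ∧
      (∀ x, ((envelope f g γ x : ℝ) : EReal) = envelopeInf f g γ x) ∧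
      (ContDiffAt ℝ 1 (prox γ g) (forward f γ xs) →
        ∃ U : Set (EuclideanSpace ℝ (Fin n)), IsOpen U ∧ xs ∈ U ∧
          -- all derivatives below exist
          ContDiffOn ℝ 3 f U ∧ ContDiffOn ℝ 2 (envelope f g γ) U ∧
          (∀ x ∈ U, DifferentiableAt ℝ (prox γ g) (forward f γ x)) ∧
          (∀ x ∈ U, generalizedHessian f g γ x = {B f g γ x}) ∧
          (∀ x ∈ U,
            ‖hessian (envelope f g γ) x - B f g γ x‖ = ‖M f g γ x‖ ∧
            ‖M f g γ x‖ ≤ γ * ‖iteratedFDeriv ℝ 3 f x‖ * ‖residual f g γ x‖)) := by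
  obtain ⟨γ₀, hγ₀, hγ₀g⟩ := EReal.lt_iff_exists_real_btwn.1 hg_bdd.1
  have hγ₀ : 0 < γ₀ := EReal.coe_pos.1 hγ₀
  obtain ⟨m, hm⟩ := hg_bdd.2 γ₀ hγ₀ hγ₀g
  -- `γ < γ₀` serves existence; the other bound gives `ρ γ < 1`, whatever the sign of `ρ`.
  refine ⟨min γ₀ (1 / (|ρ| + 1)), by positivity, fun γ hγ hlt => ?_⟩
  obtain ⟨hlt₀, hltρ⟩ := lt_min_iff.1 hlt
  have hργ : ρ * γ < 1 := by
    rw [lt_div_iff₀ (by positivity)] at hltρ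
    nlinarith [le_abs_self ρ]
  have hne : ∀ y, (proxSet γ g y).Nonempty := proxSet_nonempty hg_proper hg_lsc hγ hlt₀ hm
  refine ⟨fun y => (proxSet_subsingleton hg_proper hg_wc hγ hργ y).eq_singleton_of_mem
    (prox_mem_proxSet (hne y)), fun x => ?_, fun hC => ?_⟩
  · rw [envelope_eq hg_proper hγ hne, envelopeInf_eq hg_proper hγ hne]
  have hF : ContinuousAt (forward f γ) xs :=
    continuousAt_id.sub (hLf.continuous.continuousAt.const_smul γ)
  -- Both smoothness conditions are open, so they persist near `xs`.
  have hev : ∀ᶠ x in 𝓝 xs,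
      ContDiffAt ℝ 3 f x ∧ ContDiffAt ℝ 1 (prox γ g) (forward f γ x) :=
    (hf3.eventually (by simp)).and (hF.eventually (hC.eventually (by simp)))
  obtain ⟨U, hU, hUo, hxU⟩ := eventually_nhds_iff.1 hev
  refine ⟨U, hUo, hxU, fun x hx => (hU x hx).1.contDiffWithinAt,
    fun x hx => (contDiffAt_envelope hg_proper hγ hne (hU x hx).1 (hU x hx).2).contDiffWithinAt,
    fun x hx => (hU x hx).2.differentiableAt (by norm_num),
    fun x hx => generalizedHessian_eq (hU x hx).1 (hU x hx).2,
    fun x hx => ⟨?_, norm_M_le g hγ (hU x hx).1⟩⟩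
  rw [hessian_envelope hg_proper hγ hne hUo (fun y hy => (hU y hy).1) (fun y hy => (hU y hy).2) hx,
    add_sub_cancel_right]
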